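/- Let $k\ge 2$ be an integer. For a $k$-tuple $\mathbf c=(c_1,\dots,c_k)$ of positive integers let $\eta_{\mathbf c}$ be the morphism of the free monoid $\{0,\dots,k-1\}^*$ with $\eta_{\mathbf c}(j)=0^{c_{j+1}}(j+1)$ for $0\le j<k-1$ and $\eta_{\mathbf c}(k-1)=0^{c_k}$, and let $S=\{\eta_{\mathbf c} : c_1\ge\cdots\ge c_k\ge 1\}$. A Cantor real base is a sequence $B=(\beta_n)_{n\in\mathbb Z}$ of real numbers $\beta_n>1$ with $\prod_{n\ge 1}\beta_n=\prod_{n\ge1}\beta_{-n}=+\infty$. A $B$-representation of a real number $x\ge 0$ is a sequence $(a_n)_{n\in\mathbb Z}$ of non-negative integers, with $a_n=0$ for all sufficiently large $n$, such that $x=\sum_{n\ge0}a_n\beta_{n-1}\cdots\beta_0+\sum_{n\ge1}\frac{a_{-n}}{\beta_{-1}\cdots\beta_{-n}}$. The $B$-expansion of $x$ is its largest $B$-representation in the radix order, where $(a_n)<(b_n)$ if there is an $i\in\mathbb Z$ with $a_i<b_i$ and $a_j=b_j$ for all $j>i$. A $B$-integer is a real number $x\ge0$ whose $B$-expansion satisfies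 $a_n=0$ for all $n<0$. An infinite word $w_0w_1w_2\cdots$ is the faithful coding of the $B$-integers (unique up to renaming the letters) if the $B$-integers form a strictly increasing sequence $x_0<x_1<x_2<\cdots$ and, for all $m,n\ge 0$, $w_m=w_n$ if and only if $x_{m+1}-x_m=x_{n+1}-x_n$. Theorem. Let $\psi_n\in S$ for all $n\ge0$. Then the finite words $\psi_0\psi_1\cdots\psi_{n-1}(0)$ converge to an infinite word as $n\to\infty$ (that is, for each position $i$, the $i$-th letter exists and is constant for all sufficiently large $n$), and the limit $\lim_{n\to\infty}\psi_0\psi_1\cdots\psi_{n-1}(0)$ is the faithful coding of the $B$-integers for some Cantor real base $B$. -/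

import Mathlib

open Filter

namespace CantorBase

/-- A Cantor real base: a bi-infinite sequence of reals `β n > 1` such that
`∏_{n ≥ 1} β n = ∏_{n ≥ 1} β (-n) = +∞`. -/
structure IsCantorRealBase (β : ℤ → ℝ) : Prop where
  one_lt : ∀ n : ℤ, 1 < β n
  prod_pos : Tendsto (fun N : ℕ => ∏ i ∈ Finset.range N, β ((i : ℤ) + 1)) atTop atTop
  prod_neg : Tendsto (fun N : ℕ => ∏ i ∈ Finset.range N, β (-((i : ℤ) + 1))) atTop atTop

/-- The weight of the digit at position `n`: it is `β (n-1) ⋯ β 0` for `n ≥ 0`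
and `1 / (β (-1) ⋯ β (-m))` for `n = -m < 0`. -/
noncomputable def weight (β : ℤ → ℝ) : ℤ → ℝ
  | Int.ofNat n => ∏ i ∈ Finset.range n, β (i : ℤ)
  | Int.negSucc n => (∏ i ∈ Finset.range (n + 1), β (-((i : ℤ) + 1)))⁻¹

/-- `a` is a `B`-representation of `x`: digits in `ℕ`, zero at all large enough positions,
with `∑ a n * weight n = x` (in particular the value is finite). -/
def IsRepresentation (β : ℤ → ℝ) (a : ℤ → ℕ) (x : ℝ) : Prop :=
  (∃ N : ℤ, ∀ n : ℤ, N ≤ n → a n = 0) ∧ HasSum (fun n : ℤ => (a n : ℝ) * weight β n) x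

/-- The radix order on bi-infinite words. -/
def RadixLT (a b : ℤ → ℕ) : Prop :=
  ∃ i : ℤ, (∀ j : ℤ, i < j → a j = b j) ∧ a i < b i

/-- `a` is the `B`-expansion of `x`: the largest `B`-representation of `x` in the radix order. -/
def IsExpansion (β : ℤ → ℝ) (a : ℤ → ℕ) (x : ℝ) : Prop :=
  IsRepresentation β a x ∧ ∀ b : ℤ → ℕ, IsRepresentation β b x → b = a ∨ RadixLT b a

/-- The `B`-integers: the reals whose `B`-expansion has no fractional part. -/
def integers (β : ℤ → ℝ) : Set ℝ :=
  {x | ∃ a : ℤ → ℕ, IsExpansion β a x ∧ ∀ n : ℤ, n < 0 → a n = 0}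

/-- `w` is the faithful coding of the `B`-integers: the `B`-integers form an increasing sequence
`x 0 < x 1 < ⋯`, and two letters of `w` are equal exactly when the corresponding
distances between consecutive `B`-integers are equal. -/
def IsFaithfulCoding {A : Type*} (β : ℤ → ℝ) (w : ℕ → A) : Prop :=
  ∃ x : ℕ → ℝ, StrictMono x ∧ Set.range x = integers β ∧
    ∀ m n : ℕ, w m = w n ↔ x (m + 1) - x m = x (n + 1) - x n

/-- The morphism `η_c` of the free monoid on `{0, …, k-1}`, given by `j ↦ 0^{c_{j+1}} (j+1)` for
`j < k-1` and `k-1 ↦ 0^{c_k}`. The tuple is indexed from `0` here: `c j` is `c_{j+1}`. -/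
def eta {k : ℕ} [NeZero k] (c : Fin k → ℕ) : Monoid.End (FreeMonoid (Fin k)) :=
  FreeMonoid.lift fun j : Fin k =>
    FreeMonoid.of (0 : Fin k) ^ c j *
      if h : (j : ℕ) + 1 < k then FreeMonoid.of (⟨(j : ℕ) + 1, h⟩ : Fin k) else 1

/-- The set of all `η_c` with `c_1 ≥ ⋯ ≥ c_k ≥ 1`. -/
def etaSet (k : ℕ) [NeZero k] : Set (Monoid.End (FreeMonoid (Fin k))) :=
  {f | ∃ c : Fin k → ℕ, Antitone c ∧ (∀ j, 1 ≤ c j) ∧ f = eta c}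

/-- The finite word `ψ_0 ψ_1 ⋯ ψ_{n-1} (0)`. Multiplication in `Monoid.End` is composition. -/
def sadicWord {k : ℕ} [NeZero k] (ψ : ℕ → Monoid.End (FreeMonoid (Fin k))) (n : ℕ) :
    List (Fin k) :=
  (((List.range n).map ψ).prod (FreeMonoid.of (0 : Fin k))).toList

/-- The infinite word `w` is the limit of the finite words `ψ_0 ⋯ ψ_{n-1} (0)`: for every position
`i`, all but finitely many of these words have a letter at position `i`, and it is `w i`. -/
def IsSadicLimit {k : ℕ} [NeZero k] (ψ : ℕ → Monoid.End (FreeMonoid (Fin k)))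
    (w : ℕ → Fin k) : Prop :=
  ∀ i : ℕ, ∀ᶠ n in atTop, (sadicWord ψ n)[i]? = some (w i)

end CantorBase

namespace CantorBase

/-! Give the letters distinct positive lengths, decreasing in the letter, with `0` of length 1. Let
L_n(i) be the total length of ψ_0⋯ψ_{n-1}(i), and W_n = L_n(0). Choose the base so that the weight
at position n ≥ 0 is W_n.

On the greedy side, the B-integers are the finite sums ∑ a_j W_j with ∑_{j<m} a_j W_j < W_m for
every m (`integers_baseOfWeights`). On the word side, ψ_0⋯ψ_n(i) is c_{i+1} copies of the previous
image of `0`, then the previous image of i+1. Reading the number of complete copies passed as a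
digit, induction shows that the lengths of the proper prefixes are exactly the greedy sums below
L_{n+1}(i) (`mem_prefixSums_letterImage`). This needs L_n(i+1) ≤ L_n(0), which the monotonicity of c
provides.

The prefix lengths of the limit word are therefore the B-integers, and consecutive differences are
letter lengths, which determine the letters. -/

/-! ### A base with prescribed weights -/

/-- The base whose weights at the positions `n ≥ 0` are proportional to `W n`, and which is binary
to the right of the radix point. -/
noncomputable def baseOfWeights (W : ℕ → ℝ) : ℤ → ℝ
  | Int.ofNat n => W (n + 1) / W n
  | Int.negSucc _ => 2

theorem weight_baseOfWeights_natCast {W : ℕ → ℝ} (hW : ∀ n, 0 < W n) (h0 : W 0 = 1) (n : ℕ) :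
    weight (baseOfWeights W) (n : ℤ) = W n := by
  have : weight (baseOfWeights W) (n : ℤ) = ∏ i ∈ Finset.range n, W (i + 1) / W i := rfl
  rw [this]
  induction n with
  | zero => simp [h0]
  | succ n ih =>
    rw [Finset.prod_range_succ, ih rfl]
    field_simp [(hW n).ne']

theorem baseOfWeights_neg (W : ℕ → ℝ) (i : ℕ) : baseOfWeights W (-((i : ℤ) + 1)) = 2 := by
  rw [← Int.negSucc_eq]
  rfl

theorem weight_baseOfWeights_negSucc (W : ℕ → ℝ) (n : ℕ) :
    weight (baseOfWeights W) (Int.negSucc n) = (2 ^ (n + 1))⁻¹ := by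
  simp only [weight, baseOfWeights_neg, Finset.prod_const, Finset.card_range]

theorem isCantorRealBase_baseOfWeights {W : ℕ → ℝ} (hW : ∀ n, 0 < W n) (hmono : StrictMono W)
    (hlim : Tendsto W atTop atTop) : IsCantorRealBase (baseOfWeights W) where
  one_lt n := by
    cases n with
    | ofNat n => exact (one_lt_div (hW n)).2 (hmono n.lt_succ_self)
    | negSucc n => exact one_lt_two
  prod_pos := by
    have h : ∀ N : ℕ, ∏ i ∈ Finset.range N, baseOfWeights W ((i : ℤ) + 1) = W (N + 1) / W 1 := by
      intro N
      induction N with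
      | zero => simp [(hW 1).ne']
      | succ N ih =>
        have : baseOfWeights W ((N : ℤ) + 1) = W (N + 1 + 1) / W (N + 1) := rfl
        rw [Finset.prod_range_succ, ih, this]
        field_simp [(hW 1).ne', (hW (N + 1)).ne']
    simp only [h]
    exact (hlim.comp (tendsto_add_atTop_nat 1)).atTop_div_const (hW 1)
  prod_neg := by
    simp only [baseOfWeights_neg, Finset.prod_const, Finset.card_range]
    exact tendsto_pow_atTop_atTop_of_one_lt one_lt_two

/-! ### Expansions and the greedy condition -/

/-- Digits are unbounded, so the integer part of `y` fits in the first digit. Hence any non-negative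
excess can be stored to the right of the radix point. -/
theorem exists_hasSum_binary {y : ℝ} (hy : 0 ≤ y) :
    ∃ d : ℕ → ℕ, HasSum (fun i => (d i : ℝ) * (2 ^ (i + 1))⁻¹) y := by
  have h := Real.hasSum_ofDigitsTerm_digits (Int.fract y) (b := 2) one_lt_two
    ⟨Int.fract_nonneg y, Int.fract_lt_one y⟩
  have h2 := h.add (hasSum_ite_eq (0 : ℕ) ((⌊y⌋₊ : ℕ) : ℝ))
  refine ⟨fun i => (Real.digits (Int.fract y) 2 i : ℕ) + if i = 0 then 2 * ⌊y⌋₊ else 0, ?_⟩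
  have hf : Int.fract y + (⌊y⌋₊ : ℝ) = y := by
    rw [natCast_floor_eq_intCast_floor hy, Int.fract_add_floor]
  rw [hf] at h2
  refine h2.congr_fun ?_
  intro i
  by_cases hi : i = 0
  · subst hi; simp [Real.ofDigitsTerm]; ring
  · simp [Real.ofDigitsTerm, hi]

/-- Extension by zero of digits at non-negative positions. -/
def intDigits (a : ℕ → ℕ) : ℤ → ℕ
  | Int.ofNat n => a n
  | Int.negSucc _ => 0

theorem hasSum_intDigits {W : ℕ → ℝ} (hW : ∀ n, 0 < W n) (h0 : W 0 = 1) {a : ℕ → ℕ} {N : ℕ}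
    (ha : ∀ j, N ≤ j → a j = 0) :
    HasSum (fun n : ℤ => (intDigits a n : ℝ) * weight (baseOfWeights W) n)
      (∑ j ∈ Finset.range N, (a j : ℝ) * W j) := by
  rw [← add_zero (∑ j ∈ Finset.range N, (a j : ℝ) * W j)]
  refine HasSum.of_nat_of_neg_add_one ?_ ?_
  · simp only [weight_baseOfWeights_natCast hW h0]
    refine hasSum_sum_of_ne_finset_zero (f := fun j => (a j : ℝ) * W j) fun j hj => ?_
    simp [ha j (by simpa using hj)]
  · convert hasSum_zero with n
    rw [← Int.negSucc_eq]
    simp [intDigits]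

theorem weight_baseOfWeights_pos {W : ℕ → ℝ} (hW : ∀ n, 0 < W n) (h0 : W 0 = 1) (n : ℤ) :
    0 < weight (baseOfWeights W) n := by
  cases n with
  | ofNat n => exact (weight_baseOfWeights_natCast hW h0 n).symm ▸ hW n
  | negSucc n => rw [weight_baseOfWeights_negSucc]; positivity

theorem hasSum_intDigits_lt {W : ℕ → ℝ} (hW : ∀ n, 0 < W n) (h0 : W 0 = 1) {a : ℕ → ℕ}
    (hg : ∀ m, ∑ j ∈ Finset.range m, (a j : ℝ) * W j < W m) (i : ℤ) :
    ∃ s, HasSum (fun n : ℤ => if n < i then (intDigits a n : ℝ) * weight (baseOfWeights W) n else 0)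
      s ∧ s < weight (baseOfWeights W) i := by
  cases i with
  | ofNat m =>
    refine ⟨_, ?_, (hg m).trans_eq (weight_baseOfWeights_natCast hW h0 m).symm⟩
    have := hasSum_intDigits hW h0 (a := fun j => if j < m then a j else 0) (N := m)
      (fun j hj => by simp [hj])
    convert this using 1
    · ext n
      cases n with
      | ofNat n => by_cases hn : n < m <;> simp [hn, intDigits]
      | negSucc n => simp [intDigits]
    · exact Finset.sum_congr rfl fun j hj => by simp [Finset.mem_range.1 hj]
  | negSucc m =>
    refine ⟨0, ?_, weight_baseOfWeights_pos hW h0 _⟩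
    convert hasSum_zero with n
    cases n with
    | ofNat n => simp [show ¬ ((n : ℤ) < Int.negSucc m) by simp; omega]
    | negSucc n => simp [intDigits]

theorem isExpansion_intDigits {W : ℕ → ℝ} (hW : ∀ n, 0 < W n) (h0 : W 0 = 1) {a : ℕ → ℕ} {N : ℕ}
    (ha : ∀ j, N ≤ j → a j = 0) (hg : ∀ m, ∑ j ∈ Finset.range m, (a j : ℝ) * W j < W m) :
    IsExpansion (baseOfWeights W) (intDigits a) (∑ j ∈ Finset.range N, (a j : ℝ) * W j) := by
  have hs := hasSum_intDigits hW h0 ha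
  have hA : ∀ n : ℤ, (N : ℤ) ≤ n → intDigits a n = 0 := by
    intro n hn
    cases n with
    | ofNat n => exact ha n (by simpa using hn)
    | negSucc n => rfl
  refine ⟨⟨⟨N, hA⟩, hs⟩, fun b hb => ?_⟩
  obtain ⟨⟨M, hM⟩, hbs⟩ := hb
  by_cases hab : b = intDigits a
  · exact Or.inl hab
  right
  obtain ⟨i, hi, hmax⟩ : ∃ i, b i ≠ intDigits a i ∧ ∀ j, b j ≠ intDigits a j → j ≤ i := by
    refine Int.exists_greatest_of_bdd ⟨max N M, fun z hz => ?_⟩ (Function.ne_iff.1 hab)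
    by_contra! hlt
    exact hz (by rw [hA z (by omega), hM z (by omega)])
  have heq : ∀ j, i < j → b j = intDigits a j := fun j hj => by
    by_contra h
    exact absurd (hmax j h) (by omega)
  refine ⟨i, heq, lt_of_le_of_ne ?_ hi⟩
  by_contra! hlt
  obtain ⟨s, hs', hsi⟩ := hasSum_intDigits_lt hW h0 hg i
  -- Clear the digits of `a` below `i` and add one at `i`: `b` dominates the result termwise, yet
  -- its value `x - s + weight i` exceeds `x`.
  have h1 := (hs.sub hs').add (hasSum_ite_eq i (weight (baseOfWeights W) i))
  have h2 := hasSum_le (fun n => ?_) h1 hbs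
  · linarith
  have hw := weight_baseOfWeights_pos hW h0 n
  rcases lt_trichotomy n i with h | h | h
  · simp only [h, h.ne, if_true, if_false, sub_self, zero_add]
    positivity
  · subst h
    simp only [lt_irrefl, if_true, if_false, sub_zero]
    have : (intDigits a n : ℝ) + 1 ≤ b n := by exact_mod_cast hlt
    nlinarith
  · simp [h.not_gt, h.ne', heq n h]

/-- If the digits below `m` were worth at least `W m`, one could carry into position `m` and write
the excess in binary at negative positions, obtaining a larger representation. -/
theorem sum_lt_of_isExpansion {W : ℕ → ℝ} (hW : ∀ n, 0 < W n) (h0 : W 0 = 1) {a : ℤ → ℕ} {x : ℝ}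
    (ha : IsExpansion (baseOfWeights W) a x) (hneg : ∀ n : ℤ, n < 0 → a n = 0) (m : ℕ) :
    ∑ j ∈ Finset.range m, (a j : ℝ) * W j < W m := by
  by_contra! hle
  obtain ⟨⟨⟨M, hM⟩, hs⟩, hmax⟩ := ha
  obtain ⟨d, hd⟩ := exists_hasSum_binary (sub_nonneg.2 hle)
  let b : ℤ → ℕ := fun n => match n with
    | Int.ofNat j => if j < m then 0 else if j = m then a j + 1 else a j
    | Int.negSucc i => d i
  have hbm : b m = a m + 1 := by
    change (if m < m then 0 else if m = m then a m + 1 else a m) = _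
    simp
  have hbgt : ∀ j : ℤ, (m : ℤ) < j → b j = a j := by
    intro j hj
    cases j with
    | ofNat j =>
      have : m < j := by simpa using hj
      change (if j < m then 0 else if j = m then a j + 1 else a j) = _
      simp [this.not_gt, this.ne']
    | negSucc j => omega
  have key : IsRepresentation (baseOfWeights W) b x := by
    refine ⟨⟨max M (m + 1), fun n hn => ?_⟩, ?_⟩
    · rw [hbgt n (by omega), hM n (by omega)]
    have haN : HasSum (fun j : ℕ => (a j : ℝ) * W j) x := by
      have h3 := (Nat.cast_injective (R := ℤ)).hasSum_iff (a := x)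
        (f := fun n : ℤ => (a n : ℝ) * weight (baseOfWeights W) n) (fun n hn => by
          have : n < 0 := by
            by_contra! h
            exact hn ⟨n.toNat, by simp [h]⟩
          simp [hneg n this])
      simpa [Function.comp_def, weight_baseOfWeights_natCast hW h0] using h3.2 hs
    have hlow : HasSum (fun j : ℕ => if j < m then (a j : ℝ) * W j else 0)
        (∑ j ∈ Finset.range m, (a j : ℝ) * W j) := by
      rw [Finset.sum_congr rfl fun j hj => (if_pos (Finset.mem_range.1 hj)).symm]
      exact hasSum_sum_of_ne_finset_zero fun j hj => if_neg (by simpa using hj)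
    have hx : x = (x - ∑ j ∈ Finset.range m, (a j : ℝ) * W j + W m) +
      (∑ j ∈ Finset.range m, (a j : ℝ) * W j - W m) := by ring
    rw [hx]
    refine HasSum.of_nat_of_neg_add_one ?_ ?_
    · refine ((haN.sub hlow).add (hasSum_ite_eq m (W m))).congr_fun fun j => ?_
      rw [weight_baseOfWeights_natCast hW h0]
      rcases lt_trichotomy j m with h | h | h
      · have : b j = 0 := if_pos h
        simp [this, h, h.ne]
      · subst h
        simp [hbm]
        ring
      · simp [hbgt j (by simpa using h), h.not_gt, h.ne']
    · convert hd using 2 with n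
      rw [← Int.negSucc_eq, weight_baseOfWeights_negSucc]
  rcases hmax b key with h | ⟨i, hi, hlt⟩
  · rw [h] at hbm
    omega
  · rcases lt_trichotomy i m with h | h | h
    · have := hi m h
      omega
    · subst h
      omega
    · rw [hbgt i h] at hlt
      omega

/-! ### Greedy sums and B-integers -/

/-- The elements of the set of non-negative numbers with greedy digits at the positions below
`n`, relative to the weights `W`. -/
def greedySet (W : ℕ → ℝ) : ℕ → Set ℝ
  | 0 => {0}
  | n + 1 => {x | x < W (n + 1) ∧ ∃ a : ℕ, ∃ y ∈ greedySet W n, x = a * W n + y}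

theorem mem_greedySet_iff {W : ℕ → ℝ} (h0 : W 0 = 1) {n : ℕ} {x : ℝ} :
    x ∈ greedySet W n ↔ ∃ a : ℕ → ℕ, (∀ m ≤ n, ∑ j ∈ Finset.range m, (a j : ℝ) * W j < W m) ∧
      x = ∑ j ∈ Finset.range n, (a j : ℝ) * W j := by
  induction n generalizing x with
  | zero => simp [greedySet, h0]
  | succ n ih =>
    constructor
    · rintro ⟨hx, c, y, hy, rfl⟩
      obtain ⟨a, ha, rfl⟩ := ih.1 hy
      have hsum : ∀ m ≤ n, ∑ j ∈ Finset.range m, ((Function.update a n c j : ℕ) : ℝ) * W j =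
          ∑ j ∈ Finset.range m, (a j : ℝ) * W j := fun m hm =>
        Finset.sum_congr rfl fun j hj => by
          rw [Function.update_of_ne (by have := Finset.mem_range.1 hj; omega)]
      have hlast : (c : ℝ) * W n + ∑ j ∈ Finset.range n, (a j : ℝ) * W j =
          ∑ j ∈ Finset.range (n + 1), ((Function.update a n c j : ℕ) : ℝ) * W j := by
        rw [Finset.sum_range_succ, hsum n le_rfl, Function.update_self, add_comm]
      refine ⟨Function.update a n c, fun m hm => ?_, hlast⟩
      rcases hm.lt_or_eq with h | rfl
      · rw [hsum m (by omega)]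
        exact ha m (by omega)
      · rwa [← hlast]
    · rintro ⟨a, ha, rfl⟩
      exact ⟨ha _ le_rfl, a n, _, ih.2 ⟨a, fun m hm => ha m (by omega), rfl⟩,
        by rw [Finset.sum_range_succ, add_comm]⟩

theorem integers_baseOfWeights {W : ℕ → ℝ} (hW : ∀ n, 0 < W n) (h0 : W 0 = 1)
    (hmono : StrictMono W) : integers (baseOfWeights W) = ⋃ n, greedySet W n := by
  ext x
  simp only [Set.mem_iUnion]
  constructor
  · rintro ⟨a, ha, hneg⟩
    have hg := sum_lt_of_isExpansion hW h0 ha hneg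
    obtain ⟨⟨⟨M, hM⟩, hs⟩, -⟩ := ha
    refine ⟨M.toNat, (mem_greedySet_iff h0).2 ⟨fun j => a j, fun m _ => hg m, ?_⟩⟩
    refine hs.unique ?_
    convert hasSum_intDigits hW h0 (a := fun j => a j) (N := M.toNat)
      (fun j hj => hM j (by omega)) using 4 with n
    cases n with
    | ofNat n => rfl
    | negSucc n => exact hneg _ (Int.negSucc_lt_zero n)
  · rintro ⟨n, hn⟩
    obtain ⟨a, ha, rfl⟩ := (mem_greedySet_iff h0).1 hn
    have hsum : ∀ m ≤ n, ∑ j ∈ Finset.range m, ((if j < n then a j else 0 : ℕ) : ℝ) * W j =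
        ∑ j ∈ Finset.range m, (a j : ℝ) * W j := fun m hm =>
      Finset.sum_congr rfl fun j hj => by
        rw [if_pos (by have := Finset.mem_range.1 hj; omega)]
    rw [← hsum n le_rfl]
    refine ⟨_, isExpansion_intDigits hW h0 (fun j hj => if_neg hj.not_gt) fun m => ?_, ?_⟩
    · rcases le_total m n with h | h
      · rw [hsum m h]
        exact ha m h
      -- Past `n` the partial sums no longer change while `W` increases, so the bound at `n`
      -- suffices.
      · refine lt_of_eq_of_lt ?_ ((ha n le_rfl).trans_le (hmono.monotone h))
        rw [← hsum n le_rfl]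
        refine (Finset.sum_subset (Finset.range_mono h) fun j _ hj => ?_).symm
        simp [show ¬ j < n by simpa using hj]
    · intro j hj
      cases j with
      | ofNat j => simp at hj; omega
      | negSucc j => rfl

/-! ### Prefix sums of words -/

/-- The sum of `f` over the letters of a word. -/
def wordSum {A : Type*} (f : A → ℝ) (l : List A) : ℝ := (l.map f).sum

/-- The sums of `f` over the proper prefixes of a word. -/
def prefixSums {A : Type*} (f : A → ℝ) (l : List A) : Set ℝ :=
  {x | ∃ m < l.length, x = wordSum f (l.take m)}

section Words

variable {A : Type*} (f : A → ℝ)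

theorem wordSum_append (l l' : List A) : wordSum f (l ++ l') = wordSum f l + wordSum f l' := by
  simp [wordSum]

theorem prefixSums_nil : prefixSums f [] = ∅ := by
  simp [prefixSums]

theorem mem_prefixSums_append {l l' : List A} {x : ℝ} :
    x ∈ prefixSums f (l ++ l') ↔
      x ∈ prefixSums f l ∨ ∃ y ∈ prefixSums f l', x = wordSum f l + y := by
  constructor
  · rintro ⟨m, hm, rfl⟩
    rcases lt_or_ge m l.length with h | h
    · exact Or.inl ⟨m, h, by rw [List.take_append_of_le_length h.le]⟩
    · refine Or.inr ⟨_, ⟨m - l.length, by simp at hm; omega, rfl⟩, ?_⟩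
      rw [List.take_append, List.take_of_length_le h, wordSum_append]
  · rintro (⟨m, hm, rfl⟩ | ⟨_, ⟨m, hm, rfl⟩, rfl⟩)
    · exact ⟨m, by rw [List.length_append]; omega, by rw [List.take_append_of_le_length hm.le]⟩
    · refine ⟨l.length + m, by simpa using hm, ?_⟩
      rw [List.take_length_add_append, wordSum_append]

theorem wordSum_pow_mul (u v : FreeMonoid A) (c : ℕ) :
    wordSum f (u ^ c * v).toList = c * wordSum f u.toList + wordSum f v.toList := by
  induction c with
  | zero => simp
  | succ c ih =>
    rw [pow_succ', mul_assoc, FreeMonoid.toList_mul, wordSum_append, ih]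
    push_cast
    ring

theorem mem_prefixSums_pow_mul {u v : FreeMonoid A} {c : ℕ} {x : ℝ} :
    x ∈ prefixSums f (u ^ c * v).toList ↔
      (∃ a < c, ∃ y ∈ prefixSums f u.toList, x = a * wordSum f u.toList + y) ∨
        ∃ y ∈ prefixSums f v.toList, x = c * wordSum f u.toList + y := by
  induction c generalizing x with
  | zero => simp
  | succ c ih =>
    rw [pow_succ', mul_assoc, FreeMonoid.toList_mul, mem_prefixSums_append]
    simp only [ih]
    constructor
    · rintro (h | ⟨_, ⟨a, ha, y, hy, rfl⟩ | ⟨y, hy, rfl⟩, rfl⟩)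
      · exact Or.inl ⟨0, by omega, x, h, by simp⟩
      · exact Or.inl ⟨a + 1, by omega, y, hy, by push_cast; ring⟩
      · exact Or.inr ⟨y, hy, by push_cast; ring⟩
    · rintro (⟨a, ha, y, hy, rfl⟩ | ⟨y, hy, rfl⟩)
      · cases a with
        | zero => exact Or.inl (by simpa using hy)
        | succ a =>
          exact Or.inr ⟨_, Or.inl ⟨a, by omega, y, hy, rfl⟩, by push_cast; ring⟩
      · exact Or.inr ⟨_, Or.inr ⟨y, hy, rfl⟩, by push_cast; ring⟩

end Words

/-! ### Lengths of the images of letters -/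

section Sadic

variable {k : ℕ}

/-- The word `ψ_0 ⋯ ψ_{n-1} (i)`, which is empty when `i` is not a letter. -/
def letterImage (ψ : ℕ → Monoid.End (FreeMonoid (Fin k))) (n i : ℕ) : FreeMonoid (Fin k) :=
  if h : i < k then ((List.range n).map ψ).prod (FreeMonoid.of ⟨i, h⟩) else 1

theorem letterImage_of_le (ψ : ℕ → Monoid.End (FreeMonoid (Fin k))) (n : ℕ) {i : ℕ} (hi : k ≤ i) :
    letterImage ψ n i = 1 := dif_neg hi.not_gt

/-- Gap lengths attached to the letters: positive, strictly decreasing, with `0` of length `1`. -/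
noncomputable def gap (i : Fin k) : ℝ := ((k - i : ℕ) : ℝ) / k

theorem gap_pos (i : Fin k) : 0 < gap i := by
  have := i.2
  exact div_pos (Nat.cast_pos.2 (by omega)) (Nat.cast_pos.2 (by omega))

/-- The total gap length of `ψ_0 ⋯ ψ_{n-1} (i)`. -/
noncomputable def imageSum (ψ : ℕ → Monoid.End (FreeMonoid (Fin k))) (n i : ℕ) : ℝ :=
  wordSum gap (letterImage ψ n i).toList

theorem imageSum_zero (ψ : ℕ → Monoid.End (FreeMonoid (Fin k))) (i : Fin k) :
    imageSum ψ 0 i = gap i := by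
  simp [imageSum, letterImage, wordSum]

theorem one_le_coeff_mul {c : Fin k → ℕ} (hc : ∀ j, 1 ≤ c j) (i : Fin k) {x : ℝ} (hx : 0 ≤ x) :
    x ≤ c i * x :=
  le_mul_of_one_le_left hx (Nat.one_le_cast.2 (hc i))

theorem imageSum_of_le (ψ : ℕ → Monoid.End (FreeMonoid (Fin k))) (n : ℕ) {i : ℕ} (hi : k ≤ i) :
    imageSum ψ n i = 0 := by
  simp [imageSum, letterImage_of_le ψ n hi, wordSum]

theorem imageSum_nonneg {ψ : ℕ → Monoid.End (FreeMonoid (Fin k))} (n i : ℕ) : 0 ≤ imageSum ψ n i := by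
  refine List.sum_nonneg fun x hx => ?_
  obtain ⟨j, -, rfl⟩ := List.mem_map.1 hx
  exact (gap_pos j).le

variable [NeZero k]

theorem sadicWord_eq (ψ : ℕ → Monoid.End (FreeMonoid (Fin k))) (n : ℕ) :
    sadicWord ψ n = (letterImage ψ n 0).toList := by
  simp [letterImage, sadicWord, Nat.pos_of_ne_zero (NeZero.ne k)]

/-- Since the image at index `k` is empty, the last letter obeys the same recursion as the others.
-/
theorem letterImage_succ {ψ : ℕ → Monoid.End (FreeMonoid (Fin k))} {n : ℕ} {c : Fin k → ℕ}
    (hc : ψ n = eta c) (i : Fin k) :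
    letterImage ψ (n + 1) i = letterImage ψ n 0 ^ c i * letterImage ψ n (i + 1) := by
  have h0 : 0 < k := Nat.pos_of_ne_zero (NeZero.ne k)
  have : (⟨0, h0⟩ : Fin k) = 0 := rfl
  have hprod : ∀ u, ((List.range (n + 1)).map ψ).prod u =
      ((List.range n).map ψ).prod (eta c u) := fun u => by
    rw [List.range_succ, List.map_append, List.prod_append, List.map_singleton, List.prod_singleton,
      hc]
    rfl
  have heta : eta c (FreeMonoid.of i) = FreeMonoid.of (0 : Fin k) ^ c i *
      if h : (i : ℕ) + 1 < k then FreeMonoid.of (⟨(i : ℕ) + 1, h⟩ : Fin k) else 1 :=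
    FreeMonoid.lift_eval_of _ _
  by_cases h : (i : ℕ) + 1 < k <;> simp [letterImage, hprod, heta, h0, this, h]

theorem gap_zero : gap (0 : Fin k) = 1 := by
  simp [gap, NeZero.ne k]

theorem gap_injective : Function.Injective (gap : Fin k → ℝ) := by
  intro i j h
  have hk : (k : ℝ) ≠ 0 := Nat.cast_ne_zero.2 (NeZero.ne k)
  have h' : (k - i : ℕ) = (k - j : ℕ) := by exact_mod_cast (div_left_inj' hk).1 h
  ext
  omega

theorem imageSum_succ {ψ : ℕ → Monoid.End (FreeMonoid (Fin k))} {n : ℕ} {c : Fin k → ℕ}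
    (hc : ψ n = eta c) (i : Fin k) :
    imageSum ψ (n + 1) i = c i * imageSum ψ n 0 + imageSum ψ n (i + 1) := by
  rw [imageSum, letterImage_succ hc, wordSum_pow_mul]
  rfl

variable {ψ : ℕ → Monoid.End (FreeMonoid (Fin k))}

/-- The order of the lengths survives each step because `c` is non-increasing. -/
theorem imageSum_succ_lt (hψ : ∀ n, ψ n ∈ etaSet k) (n : ℕ) {i : ℕ} (hi : i < k) :
    imageSum ψ n (i + 1) < imageSum ψ n i := by
  induction n generalizing i with
  | zero =>
    rcases Nat.lt_or_ge (i + 1) k with h | h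
    · have h1 := imageSum_zero ψ ⟨i, hi⟩
      have h2 := imageSum_zero ψ ⟨i + 1, h⟩
      simp only at h1 h2
      rw [h1, h2]
      simp only [gap]
      have : (0 : ℝ) < k := Nat.cast_pos.2 (by omega)
      gcongr
      omega
    · rw [imageSum_of_le ψ 0 h]
      exact (gap_pos ⟨i, hi⟩).trans_eq (imageSum_zero ψ ⟨i, hi⟩).symm
  | succ n ih =>
    obtain ⟨c, hc, hc1, hη⟩ := hψ n
    have hanti : ∀ d, 0 ≤ imageSum ψ n (k - d) := by
      intro d
      induction d with
      | zero => rw [imageSum_of_le ψ n (by omega)]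
      | succ d ihd =>
        rcases Nat.lt_or_ge d k with h | h
        · have := ih (i := k - (d + 1)) (by omega)
          rw [show k - (d + 1) + 1 = k - d by omega] at this
          exact ihd.trans this.le
        · rwa [show k - (d + 1) = k - d by omega]
    have h0 : 0 < imageSum ψ n 0 := by
      have h1 := hanti (k - 1)
      rw [show k - (k - 1) = 1 by omega] at h1
      exact h1.trans_lt (ih (by omega))
    have e1 := imageSum_succ hη ⟨i, hi⟩
    simp only at e1
    rw [e1]
    rcases Nat.lt_or_ge (i + 1) k with h | h
    · have e2 := imageSum_succ hη ⟨i + 1, h⟩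
      simp only at e2
      rw [e2]
      have hle : (c ⟨i + 1, h⟩ : ℝ) ≤ c ⟨i, hi⟩ :=
        Nat.cast_le.2 (hc (Fin.mk_le_mk.2 (Nat.le_succ i)))
      have := mul_le_mul_of_nonneg_right hle h0.le
      linarith [ih h]
    · rw [imageSum_of_le ψ _ h, imageSum_of_le ψ _ h]
      have : (0 : ℝ) < c ⟨i, hi⟩ := Nat.cast_pos.2 (hc1 _)
      positivity

theorem imageSum_antitone (hψ : ∀ n, ψ n ∈ etaSet k) (n : ℕ) : Antitone (imageSum ψ n) := by
  refine antitone_nat_of_succ_le fun i => ?_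
  rcases Nat.lt_or_ge i k with h | h
  · exact (imageSum_succ_lt hψ n h).le
  · rw [imageSum_of_le ψ n h, imageSum_of_le ψ n (by omega)]

theorem imageSum_zero_zero : imageSum ψ 0 0 = 1 :=
  (imageSum_zero ψ 0).trans gap_zero

theorem le_imageSum (hψ : ∀ n, ψ n ∈ etaSet k) (n : ℕ) {i : ℕ} (hi : i < k) :
    (k : ℝ)⁻¹ ≤ imageSum ψ n i := by
  induction n generalizing i with
  | zero =>
    refine le_of_le_of_eq ?_ (imageSum_zero ψ ⟨i, hi⟩).symm
    rw [gap, inv_eq_one_div]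
    have : (1 : ℝ) ≤ (k - i : ℕ) := Nat.one_le_cast.2 (by omega)
    simp only
    gcongr
  | succ n ih =>
    obtain ⟨c, -, hc1, hη⟩ := hψ n
    have e := imageSum_succ hη ⟨i, hi⟩
    simp only at e
    have h0 := ih (i := 0) (by omega)
    linarith [one_le_coeff_mul hc1 ⟨i, hi⟩ (imageSum_nonneg (ψ := ψ) n 0),
      imageSum_nonneg (ψ := ψ) n (i + 1)]

/-- As `k ≥ 2`, the new image of `0` also contains an image of the letter 1, whose length is at
least the smallest gap `1/k`. -/
theorem imageSum_zero_add_le (hk : 2 ≤ k) (hψ : ∀ n, ψ n ∈ etaSet k) (n : ℕ) :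
    imageSum ψ n 0 + (k : ℝ)⁻¹ ≤ imageSum ψ (n + 1) 0 := by
  obtain ⟨c, -, hc1, hη⟩ := hψ n
  have e := imageSum_succ hη 0
  simp only [Fin.val_zero, zero_add] at e
  rw [e]
  exact add_le_add (one_le_coeff_mul hc1 0 (imageSum_nonneg n 0)) (le_imageSum hψ n (by omega))

theorem imageSum_zero_pos (hψ : ∀ n, ψ n ∈ etaSet k) (n : ℕ) : 0 < imageSum ψ n 0 :=
  have hk : 0 < k := Nat.pos_of_ne_zero (NeZero.ne k)
  (inv_pos.2 (Nat.cast_pos.2 hk)).trans_le (le_imageSum hψ n hk)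

theorem strictMono_imageSum_zero (hk : 2 ≤ k) (hψ : ∀ n, ψ n ∈ etaSet k) :
    StrictMono fun n => imageSum ψ n 0 := by
  refine strictMono_nat_of_lt_succ fun n => ?_
  have : (0 : ℝ) < (k : ℝ)⁻¹ := inv_pos.2 (Nat.cast_pos.2 (by omega))
  linarith [imageSum_zero_add_le hk hψ n]

theorem tendsto_imageSum_zero (hk : 2 ≤ k) (hψ : ∀ n, ψ n ∈ etaSet k) :
    Tendsto (fun n => imageSum ψ n 0) atTop atTop := by
  have h : ∀ n : ℕ, (n : ℝ) * (k : ℝ)⁻¹ ≤ imageSum ψ n 0 := by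
    intro n
    induction n with
    | zero => simpa using imageSum_nonneg 0 0
    | succ n ih =>
      push_cast
      linarith [imageSum_zero_add_le hk hψ n]
  refine tendsto_atTop_mono h (tendsto_natCast_atTop_atTop.atTop_mul_const ?_)
  exact inv_pos.2 (Nat.cast_pos.2 (by omega))

/-! ### Prefix sums are greedy sums -/

theorem nonneg_of_mem_greedySet {W : ℕ → ℝ} (hW : ∀ n, 0 < W n) {n : ℕ} {x : ℝ}
    (hx : x ∈ greedySet W n) : 0 ≤ x := by
  induction n generalizing x with
  | zero => exact (Set.mem_singleton_iff.1 hx).ge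
  | succ n ih =>
    obtain ⟨-, a, y, hy, rfl⟩ := hx
    exact add_nonneg (mul_nonneg a.cast_nonneg (hW n).le) (ih hy)

theorem lt_of_mem_greedySet {W : ℕ → ℝ} (hW : ∀ n, 0 < W n) {n : ℕ} {x : ℝ}
    (hx : x ∈ greedySet W n) : x < W n := by
  cases n with
  | zero => exact (Set.mem_singleton_iff.1 hx).trans_lt (hW 0)
  | succ n => exact hx.1

theorem mem_prefixSums_letterImage (hψ : ∀ n, ψ n ∈ etaSet k) (n i : ℕ) (x : ℝ) :
    x ∈ prefixSums gap (letterImage ψ n i).toList ↔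
      x ∈ greedySet (fun n => imageSum ψ n 0) n ∧ x < imageSum ψ n i := by
  have hW := imageSum_zero_pos hψ
  induction n generalizing i x with
  | zero =>
    rcases Nat.lt_or_ge i k with h | h
    · have hs : imageSum ψ 0 i = gap ⟨i, h⟩ := imageSum_zero ψ ⟨i, h⟩
      simp only [hs, greedySet, Set.mem_singleton_iff]
      constructor
      · rintro ⟨m, hm, rfl⟩
        have : m = 0 := by simpa [letterImage, h] using hm
        subst this
        simpa [wordSum] using gap_pos _
      · rintro ⟨rfl, -⟩
        exact ⟨0, by simp [letterImage, h], by simp [wordSum]⟩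
    · rw [letterImage_of_le ψ _ h, imageSum_of_le ψ _ h]
      simp only [FreeMonoid.toList_one, prefixSums_nil, Set.mem_empty_iff_false, false_iff, not_and,
        not_lt]
      exact fun hx => nonneg_of_mem_greedySet hW hx
  | succ n ih =>
    rcases Nat.lt_or_ge i k with h | h
    · obtain ⟨c, -, -, hη⟩ := hψ n
      have e := imageSum_succ hη ⟨i, h⟩
      have e' := letterImage_succ hη ⟨i, h⟩
      simp only at e e'
      rw [e', mem_prefixSums_pow_mul, e]
      simp only [ih]
      change ((∃ a < c ⟨i, h⟩, ∃ y, (_ ∧ y < imageSum ψ n 0) ∧ x = a * imageSum ψ n 0 + y) ∨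
        ∃ y, (_ ∧ y < imageSum ψ n (i + 1)) ∧ x = c ⟨i, h⟩ * imageSum ψ n 0 + y) ↔
        (x < imageSum ψ (n + 1) 0 ∧ ∃ a : ℕ, ∃ y ∈ greedySet (fun n => imageSum ψ n 0) n,
          x = a * imageSum ψ n 0 + y) ∧ _
      have h1 : imageSum ψ (n + 1) i ≤ imageSum ψ (n + 1) 0 :=
        imageSum_antitone hψ (n + 1) (Nat.zero_le i)
      have h2 := imageSum_nonneg (ψ := ψ) n (i + 1)
      have h3 : imageSum ψ n (i + 1) ≤ imageSum ψ n 0 := imageSum_antitone hψ n (Nat.zero_le _)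
      constructor
      · rintro (⟨a, ha, y, ⟨hy, hlt⟩, rfl⟩ | ⟨y, ⟨hy, hlt⟩, rfl⟩)
        · have : (a : ℝ) + 1 ≤ c ⟨i, h⟩ := by exact_mod_cast ha
          have := mul_le_mul_of_nonneg_right this (hW n).le
          exact ⟨⟨by linarith, a, y, hy, rfl⟩, by linarith⟩
        · exact ⟨⟨by linarith, _, y, hy, rfl⟩, by linarith⟩
      · rintro ⟨⟨-, a, y, hy, rfl⟩, hlt⟩
        have hy0 := nonneg_of_mem_greedySet hW hy
        have hyW := lt_of_mem_greedySet hW hy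
        -- The digit `a` locates the prefix: inside a copy of the image of `0`, inside the final
        -- block, or, impossibly, past the end, as that block is no longer than one copy.
        rcases lt_trichotomy a (c ⟨i, h⟩) with hac | rfl | hac
        · exact Or.inl ⟨a, hac, y, ⟨hy, hyW⟩, rfl⟩
        · exact Or.inr ⟨y, ⟨hy, by linarith⟩, rfl⟩
        · exfalso
          have : (c ⟨i, h⟩ : ℝ) + 1 ≤ a := by exact_mod_cast hac
          have := mul_le_mul_of_nonneg_right this (hW n).le
          linarith
    · rw [letterImage_of_le ψ _ h, imageSum_of_le ψ _ h]
      simp only [FreeMonoid.toList_one, prefixSums_nil, Set.mem_empty_iff_false, false_iff, not_and,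
        not_lt]
      exact fun hx => nonneg_of_mem_greedySet hW hx

theorem prefixSums_sadicWord (hψ : ∀ n, ψ n ∈ etaSet k) (n : ℕ) :
    prefixSums gap (sadicWord ψ n) = greedySet (fun n => imageSum ψ n 0) n := by
  ext x
  rw [sadicWord_eq, mem_prefixSums_letterImage hψ]
  exact and_iff_left_of_imp fun hx => lt_of_mem_greedySet (imageSum_zero_pos hψ) hx

/-! ### The limit word and its coding -/

theorem sadicWord_prefix_succ (hψ : ∀ n, ψ n ∈ etaSet k) (n : ℕ) :
    sadicWord ψ n <+: sadicWord ψ (n + 1) := by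
  obtain ⟨c, -, hc1, hη⟩ := hψ n
  have e := letterImage_succ hη 0
  rw [Fin.val_zero, show c 0 = (c 0 - 1) + 1 by have := hc1 0; omega, pow_succ', mul_assoc] at e
  rw [sadicWord_eq, sadicWord_eq, e, FreeMonoid.toList_mul]
  exact List.prefix_append _ _

theorem sadicWord_prefix (hψ : ∀ n, ψ n ∈ etaSet k) {m n : ℕ} (h : m ≤ n) :
    sadicWord ψ m <+: sadicWord ψ n := by
  induction n, h using Nat.le_induction with
  | base => exact List.prefix_rfl
  | succ n _ ih => exact ih.trans (sadicWord_prefix_succ hψ n)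

theorem lt_length_sadicWord (hk : 2 ≤ k) (hψ : ∀ n, ψ n ∈ etaSet k) (n : ℕ) :
    n < (sadicWord ψ n).length := by
  induction n with
  | zero => simp [sadicWord]
  | succ n ih =>
    refine Nat.lt_of_le_of_lt ih (lt_of_le_of_ne (sadicWord_prefix_succ hψ n).length_le fun h => ?_)
    have h1 := (sadicWord_prefix_succ hψ n).eq_of_length h
    rw [sadicWord_eq, sadicWord_eq] at h1
    exact (strictMono_imageSum_zero hk hψ n.lt_succ_self).ne (congrArg (wordSum gap) h1)

theorem exists_isSadicLimit (hk : 2 ≤ k) (hψ : ∀ n, ψ n ∈ etaSet k) :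
    ∃ w : ℕ → Fin k, IsSadicLimit ψ w := by
  -- The words extend one another and the `i`-th has more than `i` letters, so its letter at `i` is
  -- final.
  refine ⟨fun i => (sadicWord ψ i)[i]'(lt_length_sadicWord hk hψ i), fun i => ?_⟩
  filter_upwards [eventually_ge_atTop i] with n hn
  rw [List.getElem?_eq_some_iff]
  have hi := lt_length_sadicWord hk hψ i
  exact ⟨hi.trans_le (sadicWord_prefix hψ hn).length_le,
    ((sadicWord_prefix hψ hn).getElem hi).symm⟩

theorem IsSadicLimit.getElem?_eq (hψ : ∀ n, ψ n ∈ etaSet k) {w : ℕ → Fin k}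
    (hw : IsSadicLimit ψ w) {n i : ℕ} (hi : i < (sadicWord ψ n).length) :
    (sadicWord ψ n)[i] = w i := by
  obtain ⟨m, hm, hmn⟩ := ((hw i).and (eventually_ge_atTop n)).exists
  obtain ⟨_, h⟩ := List.getElem?_eq_some_iff.1 hm
  rw [← h]
  exact (sadicWord_prefix hψ hmn).getElem hi

theorem wordSum_take_sadicWord (hψ : ∀ n, ψ n ∈ etaSet k) {w : ℕ → Fin k}
    (hw : IsSadicLimit ψ w) {n m : ℕ} (hm : m < (sadicWord ψ n).length) :
    wordSum gap ((sadicWord ψ n).take m) = ∑ i ∈ Finset.range m, gap (w i) := by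
  induction m with
  | zero => simp [wordSum]
  | succ m ih =>
    rw [Finset.sum_range_succ, ← ih (by omega), List.take_succ_eq_append_getElem (by omega),
      wordSum_append, hw.getElem?_eq hψ]
    simp [wordSum]

theorem IsSadicLimit.isFaithfulCoding (hk : 2 ≤ k) (hψ : ∀ n, ψ n ∈ etaSet k) {w : ℕ → Fin k}
    (hw : IsSadicLimit ψ w) :
    IsFaithfulCoding (baseOfWeights fun n => imageSum ψ n 0) w := by
  refine ⟨fun m => ∑ i ∈ Finset.range m, gap (w i), ?_, ?_, fun m n => ?_⟩
  · refine strictMono_nat_of_lt_succ fun n => ?_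
    rw [Finset.sum_range_succ]
    exact lt_add_of_pos_right _ (gap_pos _)
  · rw [integers_baseOfWeights (imageSum_zero_pos hψ) imageSum_zero_zero
      (strictMono_imageSum_zero hk hψ)]
    ext x
    simp only [Set.mem_iUnion, ← prefixSums_sadicWord hψ, Set.mem_range]
    constructor
    · rintro ⟨m, rfl⟩
      have hm := lt_length_sadicWord hk hψ m
      exact ⟨m, m, hm, (wordSum_take_sadicWord hψ hw hm).symm⟩
    · rintro ⟨n, m, hm, rfl⟩
      exact ⟨m, (wordSum_take_sadicWord hψ hw hm).symm⟩
  · simp only [Finset.sum_range_succ, add_sub_cancel_left]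
    exact gap_injective.eq_iff.symm

end Sadic

end CantorBase

theorem mainTheorem7 (k : ℕ) [NeZero k] (hk : 2 ≤ k)
    (ψ : ℕ → Monoid.End (FreeMonoid (Fin k))) (hψ : ∀ n : ℕ, ψ n ∈ CantorBase.etaSet k) :
    (∃ w : ℕ → Fin k, CantorBase.IsSadicLimit ψ w) ∧
      ∀ w : ℕ → Fin k, CantorBase.IsSadicLimit ψ w →
        ∃ β : ℤ → ℝ, CantorBase.IsCantorRealBase β ∧ CantorBase.IsFaithfulCoding β w :=
  ⟨CantorBase.exists_isSadicLimit hk hψ, fun _ hw => ⟨_,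
    CantorBase.isCantorRealBase_baseOfWeights (CantorBase.imageSum_zero_pos hψ)
      (CantorBase.strictMono_imageSum_zero hk hψ) (CantorBase.tendsto_imageSum_zero hk hψ),
    hw.isFaithfulCoding hk hψ⟩⟩
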